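/- Let $0<\alpha<1$ and $\theta>-\alpha$, and let $V_1,V_2,\dots$ be independent random variables on a probability space with $V_i\sim\mathrm{beta}(1-\alpha,\theta+i\alpha)$. Put $T_0=0$, $T_n=\sum_{i=1}^n-\log(1-V_i)$ for $n\ge 1$, and let $N(t)=\max\{n\ge 0: T_n\le t\}$ for $t\ge 0$. Then, almost surely, this maximum exists for every $t\ge 0$, and there is a strictly positive random variable $T_{\alpha,\theta}$ on the same probability space such that $$t-\Big(\frac1\alpha-1\Big)\log N(t)+\log\alpha\;\longrightarrow\;\log T_{\alpha,\theta}\qquad\text{almost surely as }t\to\infty,$$ where $T_{\alpha,\theta}$ has the Lebesgue density $$f_{\alpha,\theta}(t)=\frac{\Gamma(\theta+1)}{\Gamma(\theta/\alpha+1)}\,t^{-\theta}f_\alpha(t),\qquad t>0,$$ and $f_\alpha$ is the density of the positive $\alpha$-stable law, that is, of the probability law on $(0,\infty)$ with Laplace transform $\int_0^\infty e^{-st}f_\alpha(t)\,dt=e^{-s^\alpha}$ for all $s\ge 0$. -/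

import Mathlib

open MeasureTheory ProbabilityTheory Filter Topology Set

noncomputable section

/-- The renewal epochs `T_n = ∑_{i=1}^n -log (1 - V_i)`, with `T_0 = 0`. The sequence is indexed
from `0`, so `V i` stands for the variable `V_{i+1}`. -/
def renewalEpoch {Ω : Type*} (V : ℕ → Ω → ℝ) (n : ℕ) (ω : Ω) : ℝ :=
  ∑ i ∈ Finset.range n, -Real.log (1 - V i ω)

/-- The renewal counting process `N(t) = max {n : T_n ≤ t}`. -/
def renewalCount {Ω : Type*} (V : ℕ → Ω → ℝ) (t : ℝ) (ω : Ω) : ℕ :=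
  sSup {n : ℕ | renewalEpoch V n ω ≤ t}

/-- `ν` is the positive stable law of exponent `α`: a probability measure carried by `(0, ∞)`
with Laplace transform `s ↦ exp (-s ^ α)`. -/
structure IsPositiveStableLaw (α : ℝ) (ν : Measure ℝ) : Prop where
  isProbabilityMeasure : IsProbabilityMeasure ν
  measure_Iic_zero : ν (Iic 0) = 0
  laplace : ∀ s : ℝ, 0 ≤ s → ∫ x, Real.exp (-(s * x)) ∂ν = Real.exp (-s ^ α)

/-- `f` is a density on `(0, ∞)`, with respect to Lebesgue measure, of the positive stable law of
exponent `α`. Only the values of `f` on `(0, ∞)` matter. -/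
structure IsPositiveStableDensity (α : ℝ) (f : ℝ → ℝ) : Prop where
  measurable : Measurable f
  nonneg : ∀ t : ℝ, 0 < t → 0 ≤ f t
  law : IsPositiveStableLaw α
    ((volume.restrict (Ioi 0)).withDensity fun t => ENNReal.ofReal (f t))

/-- The density `Γ(θ + 1) / Γ(θ / α + 1) * t ^ (-θ) * f t`, `t > 0`. -/
def tiltedDensity (α θ : ℝ) (f : ℝ → ℝ) (t : ℝ) : ℝ :=
  Real.Gamma (θ + 1) / Real.Gamma (θ / α + 1) * t ^ (-θ) * f t

/-- `ν` is the law of the polynomially tilted positive stable variable `T_{α,θ}`: it has on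
`(0, ∞)` the Lebesgue density `Γ(θ + 1) / Γ(θ / α + 1) * t ^ (-θ) * f_α(t)`, where `f_α` is the
density of the positive stable law of exponent `α`. -/
def IsTiltedStableLaw (α θ : ℝ) (ν : Measure ℝ) : Prop :=
  ∃ f : ℝ → ℝ, IsPositiveStableDensity α f ∧
    ν = (volume.restrict (Ioi 0)).withDensity fun t => ENNReal.ofReal (tiltedDensity α θ f t)

end

/-! Since `E (1 - V_i) ^ s` is a ratio of Gamma values, the transform `E exp (-s T_n)` is a product
that telescopes (`prod_stepMoment`) to the moment `E T ^ (-s)` of the tilted stable law times two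
Gamma ratios. By `Γ(x + a) / Γ(x + b) ~ x ^ (a - b)`, these ratios are cancelled asymptotically by
centring `T_n` with `log α - (1 / α - 1) log n`.

Exponential martingales at exponents of both signs then make the centred epochs converge almost
surely to some `Y` (`ae_exists_tendsto_centredSum`). Uniform integrability carries the moments to
the limit, and `T = exp Y` is the required variable. Sandwiching `t` between consecutive epochs
turns the asymptotics of `T_n` into those of `N(t)`.

To identify the law, the tilt is undone: weighting the law of `T` by a multiple of `t ^ θ` gives `X`
with `E X ^ (-s) = Γ(s / α + 1) / Γ(s + 1)` for `|s| < α`. If `E` is an independent standard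
exponential variable, `(E / X) ^ α` has the moments of `E`, hence its law, so `E exp (-l X) = P(E >
l X) = P(E > l ^ α) = exp (-l ^ α)` (`isPositiveStableLaw_of_moments`). The stable density is thus
produced by the construction, and it exists because `V_1` already makes the law of `Y` absolutely
continuous. -/

/-! ### Ratios of Gamma functions -/

/-- Wendel's inequality. -/
lemma Gamma_add_le_rpow_mul {x s : ℝ} (hx : 0 < x) (hs0 : 0 ≤ s) (hs1 : s ≤ 1) :
    Real.Gamma (x + s) ≤ x ^ s * Real.Gamma x := by
  rcases hs0.eq_or_lt with rfl | hs0
  · simp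
  rcases hs1.eq_or_lt with rfl | hs1
  · simp [Real.Gamma_add_one hx.ne']
  have h := Real.Gamma_mul_add_mul_le_rpow_Gamma_mul_rpow_Gamma hx (by linarith : 0 < x + 1)
    (by linarith : 0 < 1 - s) hs0 (by ring)
  have hG := Real.Gamma_pos_of_pos hx
  rw [Real.Gamma_add_one hx.ne', Real.mul_rpow hx.le hG.le, mul_left_comm, ← Real.rpow_add hG,
    sub_add_cancel, Real.rpow_one] at h
  convert h using 2
  ring

/-- Wendel's inequality at `(x, s)` bounds the ratio above by 1; at `(x + s, 1 - s)`, with `Γ(x + 1)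
= x Γ(x)`, it bounds it below. -/
lemma tendsto_Gamma_add_div_of_mem_Icc {s : ℝ} (hs0 : 0 ≤ s) (hs1 : s ≤ 1) :
    Tendsto (fun x : ℝ => Real.Gamma (x + s) / (Real.Gamma x * x ^ s)) atTop (𝓝 1) := by
  have hlow : Tendsto (fun x : ℝ => (x / (x + s)) ^ (1 - s)) atTop (𝓝 1) := by
    have h1 : Tendsto (fun x : ℝ => x / (x + s)) atTop (𝓝 1) := by
      have h2 : Tendsto (fun x : ℝ => 1 - s / (x + s)) atTop (𝓝 (1 - 0)) :=
        tendsto_const_nhds.sub (Tendsto.div_atTop tendsto_const_nhds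
          (tendsto_atTop_add_const_right _ _ tendsto_id))
      rw [sub_zero] at h2
      refine h2.congr' ?_
      filter_upwards [eventually_gt_atTop 0] with x hx
      have : x + s ≠ 0 := by positivity
      field_simp
      ring
    simpa using h1.rpow_const (p := 1 - s) (Or.inl one_ne_zero)
  refine tendsto_of_tendsto_of_tendsto_of_le_of_le' hlow tendsto_const_nhds ?_ ?_
  · filter_upwards [eventually_gt_atTop 0] with x hx
    have hxs : 0 < x + s := by positivity
    have hG := Real.Gamma_pos_of_pos hx
    have h := Gamma_add_le_rpow_mul hxs (by linarith : 0 ≤ 1 - s) (by linarith)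
    rw [show x + s + (1 - s) = x + 1 by ring, Real.Gamma_add_one hx.ne'] at h
    rw [Real.div_rpow hx.le hxs.le, div_le_div_iff₀ (by positivity) (by positivity)]
    calc x ^ (1 - s) * (Real.Gamma x * x ^ s) = (x ^ (1 - s) * x ^ s) * Real.Gamma x := by ring
      _ = x * Real.Gamma x := by rw [← Real.rpow_add hx, sub_add_cancel, Real.rpow_one]
      _ ≤ _ := by linarith
  · filter_upwards [eventually_gt_atTop 0] with x hx
    have hG := Real.Gamma_pos_of_pos hx
    rw [div_le_one (by positivity), mul_comm]
    exact Gamma_add_le_rpow_mul hx hs0 hs1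

lemma tendsto_Gamma_add_add_one_div_iff (s : ℝ) :
    Tendsto (fun x : ℝ => Real.Gamma (x + (s + 1)) / (Real.Gamma x * x ^ (s + 1))) atTop (𝓝 1) ↔
      Tendsto (fun x : ℝ => Real.Gamma (x + s) / (Real.Gamma x * x ^ s)) atTop (𝓝 1) := by
  have h1 : Tendsto (fun x : ℝ => (x + s) / x) atTop (𝓝 1) := by
    have h2 : Tendsto (fun x : ℝ => 1 + s / x) atTop (𝓝 (1 + 0)) :=
      tendsto_const_nhds.add (Tendsto.div_atTop tendsto_const_nhds tendsto_id)
    rw [add_zero] at h2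
    refine h2.congr' ?_
    filter_upwards [eventually_gt_atTop 0] with x hx
    field_simp
  have h2 : ∀ᶠ x : ℝ in atTop, Real.Gamma (x + (s + 1)) / (Real.Gamma x * x ^ (s + 1)) =
      (x + s) / x * (Real.Gamma (x + s) / (Real.Gamma x * x ^ s)) := by
    filter_upwards [eventually_gt_atTop 0, eventually_gt_atTop (-s)] with x hx hxs
    have hG := Real.Gamma_pos_of_pos hx
    rw [← add_assoc, Real.Gamma_add_one (by linarith), Real.rpow_add hx, Real.rpow_one]
    have : 0 < x ^ s := by positivity
    field_simp
  constructor
  · intro h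
    have h3 := h.div h1 one_ne_zero
    rw [div_one] at h3
    refine h3.congr' ?_
    filter_upwards [h2, eventually_gt_atTop 0, eventually_gt_atTop (-s)] with x hx hx0 hxs
    have : x + s ≠ 0 := by linarith
    rw [Pi.div_apply, hx]
    field_simp
  · intro h
    have h3 := h1.mul h
    rw [mul_one] at h3
    exact h3.congr' (h2.mono fun x hx => hx.symm)

/-- Raising `s` by 1 multiplies the ratio by `(x + s) / x → 1`, so induction on the integer part, in
both directions, reduces to the fractional part. -/
lemma tendsto_Gamma_add_div (s : ℝ) :
    Tendsto (fun x : ℝ => Real.Gamma (x + s) / (Real.Gamma x * x ^ s)) atTop (𝓝 1) := by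
  have h (k : ℤ) : Tendsto (fun x : ℝ => Real.Gamma (x + (Int.fract s + k)) /
      (Real.Gamma x * x ^ (Int.fract s + k))) atTop (𝓝 1) := by
    induction k using Int.induction_on with
    | zero =>
      simpa using tendsto_Gamma_add_div_of_mem_Icc (Int.fract_nonneg s) (Int.fract_lt_one s).le
    | succ k ih =>
      have := (tendsto_Gamma_add_add_one_div_iff _).2 ih
      push_cast at this ⊢
      simpa only [add_assoc] using this
    | pred k ih =>
      refine (tendsto_Gamma_add_add_one_div_iff _).1 ?_
      push_cast at ih ⊢
      convert ih using 5 <;> ring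
  simpa using h ⌊s⌋

/-! ### Moments of the beta law -/

lemma betaPDFReal_mul_rpow {a b s : ℝ} (ha : 0 < a) (hbs : 0 < b + s) (x : ℝ) :
    betaPDFReal a b x * (1 - x) ^ s =
      beta a (b + s) / beta a b * betaPDFReal a (b + s) x := by
  unfold betaPDFReal
  split_ifs with h
  · have h1 : 0 < 1 - x := by linarith [h.2]
    have := (beta_pos ha hbs).ne'
    rw [show b + s - 1 = (b - 1) + s by ring, Real.rpow_add h1]
    field_simp
  · simp

lemma lintegral_betaMeasure_rpow {a b s : ℝ} (ha : 0 < a) (hb : 0 < b) (hbs : 0 < b + s) :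
    ∫⁻ x, ENNReal.ofReal ((1 - x) ^ s) ∂betaMeasure a b =
      ENNReal.ofReal (beta a (b + s) / beta a b) := by
  have hpdf : Measurable (betaPDF a b) := (measurable_betaPDFReal a b).ennreal_ofReal
  have h0 (c : ℝ) (hc : 0 < c) (x : ℝ) : 0 ≤ betaPDFReal a c x := by
    by_cases h : 0 < x ∧ x < 1
    · exact (betaPDFReal_pos h.1 h.2 ha hc).le
    · simp [betaPDFReal, h]
  rw [betaMeasure, lintegral_withDensity_eq_lintegral_mul _ hpdf (by fun_prop)]
  calc ∫⁻ x, (betaPDF a b * fun x => ENNReal.ofReal ((1 - x) ^ s)) x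
      = ∫⁻ x, ENNReal.ofReal (beta a (b + s) / beta a b) * betaPDF a (b + s) x := by
        refine lintegral_congr fun x => ?_
        rw [Pi.mul_apply, betaPDF, betaPDF, ← ENNReal.ofReal_mul (h0 b hb x),
          betaPDFReal_mul_rpow ha hbs,
          ENNReal.ofReal_mul (div_nonneg (beta_pos ha hbs).le (beta_pos ha hb).le)]
    _ = _ := by
        have hpdf' : Measurable (betaPDF a (b + s)) := (measurable_betaPDFReal a _).ennreal_ofReal
        rw [lintegral_const_mul _ hpdf',
          lintegral_betaPDF_eq_one ha hbs, mul_one]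

lemma ae_mem_Ioo_betaMeasure (a b : ℝ) : ∀ᵐ x ∂betaMeasure a b, x ∈ Ioo (0 : ℝ) 1 := by
  have hpdf : Measurable (betaPDF a b) := (measurable_betaPDFReal a b).ennreal_ofReal
  rw [betaMeasure, ae_withDensity_iff hpdf]
  refine ae_of_all _ fun x hx => ?_
  by_contra h
  refine hx ?_
  have h' : ¬ (0 < x ∧ x < 1) := h
  simp [betaPDF_eq, h']

lemma beta_add_div_beta {a b s : ℝ} (ha : 0 < a) :
    beta a (b + s) / beta a b =
      Real.Gamma (b + s) * Real.Gamma (a + b) / (Real.Gamma (a + b + s) * Real.Gamma b) := by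
  have := (Real.Gamma_pos_of_pos ha).ne'
  rw [beta, beta, ← add_assoc]
  field_simp

/-! ### Null sets under changes of variable -/

/-- Up to a null set, `g ⁻¹' s` lies in `h '' (s ∩ D)`, and differentiable maps of the line send
null sets to null sets. -/
lemma map_absolutelyContinuous_of_leftInverse {μ : Measure ℝ} (hμ : μ ≪ volume) {g h : ℝ → ℝ}
    (hg : Measurable g) {D : Set ℝ} (hh : DifferentiableOn ℝ h D)
    (hgh : ∀ᵐ x ∂μ, g x ∈ D ∧ h (g x) = x) : μ.map g ≪ volume := by
  refine Measure.AbsolutelyContinuous.mk fun s hs h0 => ?_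
  rw [Measure.map_apply hg hs]
  have himg : μ (h '' (s ∩ D)) = 0 :=
    hμ (addHaar_image_eq_zero_of_differentiableOn_of_addHaar_eq_zero volume
      (hh.mono inter_subset_right) (measure_mono_null inter_subset_left h0))
  refine measure_mono_null (t := h '' (s ∩ D) ∪ {x | ¬ (g x ∈ D ∧ h (g x) = x)}) ?_
    (measure_union_null himg hgh)
  intro x hx
  by_cases hxD : g x ∈ D ∧ h (g x) = x
  · exact Or.inl ⟨g x, ⟨hx, hxD.1⟩, hxD.2⟩
  · exact Or.inr hxD

/-! ### Moment generating functions -/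

/-- Finite measures whose moment generating functions are finite and agree near `0` are equal. -/
lemma map_eq_of_mgf_eq_near_zero {Ω Ω' : Type*} [MeasurableSpace Ω] [MeasurableSpace Ω']
    {μ : Measure Ω} {μ' : Measure Ω'} [IsFiniteMeasure μ] [IsFiniteMeasure μ'] {X : Ω → ℝ}
    {Y : Ω' → ℝ} (hX : AEMeasurable X μ) (hY : AEMeasurable Y μ') {ε : ℝ} (hε : 0 < ε)
    (hXi : ∀ t ∈ Ioo (-ε) ε, Integrable (fun ω => Real.exp (t * X ω)) μ)
    (hYi : ∀ t ∈ Ioo (-ε) ε, Integrable (fun ω => Real.exp (t * Y ω)) μ')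
    (h : ∀ t ∈ Ioo (-ε) ε, mgf X μ t = mgf Y μ' t) : μ.map X = μ'.map Y := by
  have hsX : Ioo (-ε) ε ⊆ interior (integrableExpSet X μ) :=
    interior_maximal (fun t ht => hXi t ht) isOpen_Ioo
  have hsY : Ioo (-ε) ε ⊆ interior (integrableExpSet Y μ') :=
    interior_maximal (fun t ht => hYi t ht) isOpen_Ioo
  have h0 : (0 : ℝ) ∈ Ioo (-ε) ε := by simp [hε]
  -- Identity theorem on a vertical strip around the imaginary axis, where the complex transforms
  -- are the characteristic functions.
  have hEq : EqOn (complexMGF X μ) (complexMGF Y μ') {z | z.re ∈ Ioo (-ε) ε} := by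
    refine AnalyticOnNhd.eqOn_of_preconnected_of_frequently_eq
      (analyticOnNhd_complexMGF.mono fun z hz => hsX hz)
      (analyticOnNhd_complexMGF.mono fun z hz => hsY hz)
      ((convex_Ioo (-ε) ε).linear_preimage Complex.reLm).isPreconnected
      (z₀ := ((0 : ℝ) : ℂ)) (by simpa using hε) ?_
    have hreal : ∃ᶠ x : ℝ in 𝓝[≠] 0, complexMGF X μ x = complexMGF Y μ' x := by
      refine Eventually.frequently ?_
      filter_upwards [nhdsWithin_le_nhds (isOpen_Ioo.mem_nhds h0)] with x hx
      rw [complexMGF_ofReal, complexMGF_ofReal, h x hx]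
    rw [frequently_iff_seq_forall] at hreal ⊢
    obtain ⟨xs, hxs, hxs'⟩ := hreal
    refine ⟨fun n => xs n, ?_, hxs'⟩
    rw [tendsto_nhdsWithin_iff] at hxs ⊢
    exact ⟨(Complex.continuous_ofReal.tendsto 0).comp hxs.1, by simpa using hxs.2⟩
  have := Measure.isFiniteMeasure_map μ X
  have := Measure.isFiniteMeasure_map μ' Y
  refine Measure.ext_of_charFun ?_
  funext t
  rw [← complexMGF_mul_I hX, ← complexMGF_mul_I hY]
  exact hEq (by simpa using hε)

/-- Convergence of exponential moments along an almost surely convergent sequence, under a bound on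
a higher exponential moment. -/
lemma mgf_eq_of_ae_tendsto {Ω : Type*} [MeasurableSpace Ω] {P : Measure Ω} [IsProbabilityMeasure P]
    {Y : ℕ → Ω → ℝ} {Z : Ω → ℝ} (hY : ∀ n, AEMeasurable (Y n) P)
    (hlim : ∀ᵐ ω ∂P, Tendsto (fun n => Y n ω) atTop (𝓝 (Z ω))) {u p C L : ℝ} (hp : 1 < p)
    (hintp : ∀ n, Integrable (fun ω => Real.exp (p * u * Y n ω)) P)
    (hC : ∀ n, mgf (Y n) P (p * u) ≤ C)
    (hL : Tendsto (fun n => mgf (Y n) P u) atTop (𝓝 L)) :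
    Integrable (fun ω => Real.exp (u * Z ω)) P ∧ mgf Z P u = L := by
  have hC0 : 0 < C := (mgf_pos (hintp 0)).trans_le (hC 0)
  have hm (n : ℕ) : AEStronglyMeasurable (fun ω => Real.exp (u * Y n ω)) P :=
    ((hY n).const_mul u).exp.aestronglyMeasurable
  have hui : UniformIntegrable (fun n ω => Real.exp (u * Y n ω)) 1 P := by
    refine uniformIntegrable_of le_rfl ENNReal.one_ne_top hm fun ε hε => ?_
    -- Chosen so that `exp (u Y) ≥ K` forces `exp (u Y) ≤ (ε / C) exp (p u Y)`.
    set K : ℝ := (C / ε) ^ (1 / (p - 1)) with hK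
    have hp' : 0 < p - 1 := by linarith
    have hK0 : 0 < K := by positivity
    have hKp : K ^ (p - 1) = C / ε := by
      rw [hK, ← Real.rpow_mul (by positivity), one_div_mul_cancel hp'.ne', Real.rpow_one]
    refine ⟨K.toNNReal, fun n => ?_⟩
    rw [eLpNorm_one_eq_lintegral_enorm]
    calc ∫⁻ ω, ‖{ω | K.toNNReal ≤ ‖Real.exp (u * Y n ω)‖₊}.indicator
            (fun ω => Real.exp (u * Y n ω)) ω‖ₑ ∂P
        ≤ ∫⁻ ω, ENNReal.ofReal (ε / C * Real.exp (p * u * Y n ω)) ∂P := by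
          refine lintegral_mono fun ω => ?_
          by_cases hω : K.toNNReal ≤ ‖Real.exp (u * Y n ω)‖₊
          · rw [indicator_of_mem (by exact hω), Real.enorm_eq_ofReal (Real.exp_pos _).le]
            refine ENNReal.ofReal_le_ofReal ?_
            have hω' : K ≤ Real.exp (u * Y n ω) := by
              have := (Real.toNNReal_le_iff_le_coe).1 hω
              simpa [abs_of_pos (Real.exp_pos _)] using this
            have h1 : C / ε ≤ Real.exp (u * Y n ω) ^ (p - 1) := by
              rw [← hKp]
              exact Real.rpow_le_rpow hK0.le hω' hp'.le
            have h2 : Real.exp (p * u * Y n ω) =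
                Real.exp (u * Y n ω) ^ (p - 1) * Real.exp (u * Y n ω) := by
              rw [← Real.exp_mul, ← Real.exp_add]
              congr 1
              ring
            rw [h2]
            calc Real.exp (u * Y n ω) = ε / C * (C / ε * Real.exp (u * Y n ω)) := by field_simp
              _ ≤ _ := by gcongr
          · rw [indicator_of_notMem (by exact hω)]
            simp
      _ = ENNReal.ofReal (∫ ω, ε / C * Real.exp (p * u * Y n ω) ∂P) :=
          (ofReal_integral_eq_lintegral_ofReal ((hintp n).const_mul _)
            (ae_of_all _ fun ω => by positivity)).symm
      _ ≤ ENNReal.ofReal ε := by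
          refine ENNReal.ofReal_le_ofReal ?_
          rw [integral_const_mul]
          calc ε / C * ∫ ω, Real.exp (p * u * Y n ω) ∂P ≤ ε / C * C := by
                gcongr
                exact hC n
            _ = ε := by field_simp
  have hlim' : ∀ᵐ ω ∂P, Tendsto (fun n => Real.exp (u * Y n ω)) atTop (𝓝 (Real.exp (u * Z ω))) := by
    filter_upwards [hlim] with ω hω
    exact (Real.continuous_exp.tendsto _).comp (hω.const_mul u)
  have hint : Integrable (fun ω => Real.exp (u * Z ω)) P :=
    hui.integrable_of_ae_tendsto hlim'
  have hLp := tendsto_Lp_finite_of_tendsto_ae le_rfl ENNReal.one_ne_top hm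
    (memLp_one_iff_integrable.2 hint) hui.unifIntegrable hlim'
  have := tendsto_integral_of_L1' _ hint.aestronglyMeasurable
    (Eventually.of_forall fun n => memLp_one_iff_integrable.1 (hui.memLp n)) hLp
  exact ⟨hint, tendsto_nhds_unique this hL⟩

/-- The exponential martingale of a random walk with independent steps converges. -/
lemma ae_exists_tendsto_exp_sum_div {Ω : Type*} [MeasurableSpace Ω] {P : Measure Ω}
    [IsProbabilityMeasure P] {ξ : ℕ → Ω → ℝ} (hξ : ∀ i, Measurable (ξ i)) (hind : iIndepFun ξ P)
    {u : ℝ} (hint : ∀ i, Integrable (fun ω => Real.exp (u * ξ i ω)) P) :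
    ∀ᵐ ω ∂P, ∃ c, Tendsto (fun n => Real.exp (u * ∑ i ∈ Finset.range n, ξ i ω) /
      ∏ i ∈ Finset.range n, mgf (ξ i) P u) atTop (𝓝 c) := by
  have hpos (i : ℕ) : 0 < mgf (ξ i) P u := mgf_pos (hint i)
  have hprod (n : ℕ) : 0 < ∏ i ∈ Finset.range n, mgf (ξ i) P u :=
    Finset.prod_pos fun i _ => hpos i
  set M : ℕ → Ω → ℝ := fun n ω => Real.exp (u * ∑ i ∈ Finset.range n, ξ i ω) /
      ∏ i ∈ Finset.range n, mgf (ξ i) P u with hM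
  set X : ℕ → Ω → ℝ := fun n ω => Real.exp (u * ξ n ω) / mgf (ξ n) P u with hX
  have hMint (n : ℕ) : Integrable (M n) P := by
    have := hind.integrable_exp_mul_sum hξ (s := Finset.range n) (t := u) fun i _ => hint i
    simp only [Finset.sum_apply] at this
    exact this.div_const _
  have hMone (n : ℕ) : ∫ ω, M n ω ∂P = 1 := by
    have := hind.mgf_sum hξ (Finset.range n) (t := u)
    simp only [mgf, Finset.sum_apply] at this
    simp only [hM]
    rw [integral_div, this]
    exact div_self (hprod n).ne'
  have hMsucc (n : ℕ) : M (n + 1) = M n * X n := by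
    funext ω
    simp only [hM, hX, Pi.mul_apply]
    rw [Finset.sum_range_succ, Finset.prod_range_succ, mul_add, Real.exp_add, mul_div_mul_comm]
  have hXint (n : ℕ) : Integrable (X n) P := (hint n).div_const _
  have hsm (i : ℕ) : StronglyMeasurable (ξ i) := (hξ i).stronglyMeasurable
  set ℱ := Filtration.natural ξ hsm
  -- The shift is needed because `M (n + 1)` involves `ξ 0, …, ξ n`, exactly what `ℱ n` generates.
  have hadapt : StronglyAdapted ℱ fun n => M (n + 1) := by
    intro n
    refine Measurable.stronglyMeasurable ?_
    refine Measurable.div_const (Real.measurable_exp.comp (Measurable.const_mul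
      (Finset.measurable_fun_sum _ fun i hi => ?_) u)) _
    exact ((Filtration.stronglyAdapted_natural hsm i).mono
      (ℱ.mono (Nat.lt_succ_iff.1 (Finset.mem_range.1 hi)))).measurable
  have hmart : Martingale (fun n => M (n + 1)) ℱ P := by
    refine martingale_nat hadapt (fun n => hMint _) fun n => ?_
    have h1 : P[M (n + 1) * X (n + 1) | ℱ n] =ᵐ[P] M (n + 1) * P[X (n + 1) | ℱ n] :=
      condExp_mul_of_stronglyMeasurable_left (hadapt n)
        (by rw [← hMsucc]; exact hMint _) (hXint _)
    have h2 : P[X (n + 1) | ℱ n] =ᵐ[P] fun _ => ∫ ω, X (n + 1) ω ∂P := by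
      refine condExp_indep_eq (hξ (n + 1)).comap_le (ℱ.le n) ?_
        (hind.indep_comap_natural_of_lt hsm (Nat.lt_succ_self n))
      refine Measurable.stronglyMeasurable ?_
      exact (Real.measurable_exp.comp ((comap_measurable (ξ (n + 1))).const_mul u)).div_const _
    have h3 : ∫ ω, X (n + 1) ω ∂P = 1 := by
      simp only [hX]
      rw [integral_div]
      exact div_self (hpos _).ne'
    rw [hMsucc (n + 1)]
    filter_upwards [h1, h2] with ω h1 h2
    rw [h1, Pi.mul_apply, h2, h3, mul_one]
  have hconv := hmart.submartingale.exists_ae_tendsto_of_bdd (R := 1) fun n => by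
    rw [eLpNorm_one_eq_lintegral_enorm]
    have hnn (ω : Ω) : 0 ≤ M (n + 1) ω := div_nonneg (Real.exp_pos _).le (hprod _).le
    simp_rw [fun ω => Real.enorm_eq_ofReal (hnn ω)]
    rw [← ofReal_integral_eq_lintegral_ofReal (hMint _) (ae_of_all _ hnn), hMone]
    simp
  filter_upwards [hconv] with ω ⟨c, hc⟩
  exact ⟨c, (tendsto_add_atTop_iff_nat 1).1 hc⟩

/-! ### Counting function of a sequence growing logarithmically -/

section Counting

variable {S : ℕ → ℝ} {c y : ℝ}

lemma tendsto_atTop_of_tendsto_sub_log (hc : 0 < c)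
    (hy : Tendsto (fun n : ℕ => S n - c * Real.log n) atTop (𝓝 y)) : Tendsto S atTop atTop := by
  have h := hy.add_atTop
    ((Real.tendsto_log_atTop.comp tendsto_natCast_atTop_atTop).const_mul_atTop hc)
  refine h.congr fun n => ?_
  simp

/-- No monotonicity of `S` is needed: divergence bounds the set and `t ≥ 0` puts `0` in it, so
`sSup` is not a default value. -/
lemma isGreatest_sSup_setOf_le (hS0 : S 0 = 0) (hS : Tendsto S atTop atTop) {t : ℝ} (ht : 0 ≤ t) :
    IsGreatest {n : ℕ | S n ≤ t} (sSup {n : ℕ | S n ≤ t}) := by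
  have hne : {n : ℕ | S n ≤ t}.Nonempty := ⟨0, by simpa [hS0] using ht⟩
  have hbdd : BddAbove {n : ℕ | S n ≤ t} := by
    obtain ⟨m, hm⟩ := eventually_atTop.1 (hS.eventually_gt_atTop t)
    refine ⟨m, fun n hn => ?_⟩
    by_contra hlt
    exact absurd hn (not_le.2 (hm n (not_le.1 hlt).le))
  exact ⟨Nat.sSup_mem hne hbdd, fun n hn => le_csSup hbdd hn⟩

/-- By maximality `S (N t) ≤ t < S (N t + 1)`, and `log (N + 1) - log N → 0`. -/
lemma tendsto_sub_log_sSup_setOf_le (hS0 : S 0 = 0) (hc : 0 < c)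
    (hy : Tendsto (fun n : ℕ => S n - c * Real.log n) atTop (𝓝 y)) :
    Tendsto (fun t : ℝ => t - c * Real.log (sSup {n : ℕ | S n ≤ t} : ℕ)) atTop (𝓝 y) := by
  have hS := tendsto_atTop_of_tendsto_sub_log hc hy
  set N : ℝ → ℕ := fun t => sSup {n : ℕ | S n ≤ t} with hN
  have hgr {t : ℝ} (ht : 0 ≤ t) := isGreatest_sSup_setOf_le hS0 hS ht
  have hNtop : Tendsto N atTop atTop := by
    refine tendsto_atTop.2 fun m => ?_
    filter_upwards [eventually_ge_atTop 0, eventually_ge_atTop (S m)] with t ht hm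
    exact (hgr ht).2 hm
  have hlow : Tendsto (fun t => S (N t) - c * Real.log (N t)) atTop (𝓝 y) := hy.comp hNtop
  have hupp : Tendsto (fun t => S (N t + 1) - c * Real.log ((N t + 1 : ℕ) : ℝ) +
      c * (Real.log (N t + 1) - Real.log (N t))) atTop (𝓝 y) := by
    have h1 := (hy.comp (tendsto_add_atTop_nat 1)).comp hNtop
    have h2 := (Real.tendsto_log_nat_add_one_sub_log.comp hNtop).const_mul c
    simpa using h1.add h2
  refine tendsto_of_tendsto_of_tendsto_of_le_of_le' hlow hupp ?_ ?_
  · filter_upwards [eventually_ge_atTop 0] with t ht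
    have : S (N t) ≤ t := (hgr ht).1
    linarith
  · filter_upwards [eventually_ge_atTop 0] with t ht
    have : t < S (N t + 1) := by
      by_contra hle
      exact absurd ((hgr ht).2 (not_lt.1 hle)) (Nat.not_succ_le_self _)
    push_cast
    linarith

end Counting

/-! ### The positive stable law from its moments -/

/-- The standard exponential law. -/
noncomputable def stdExpLaw : Measure ℝ :=
  (volume.restrict (Ioi 0)).withDensity fun x => ENNReal.ofReal (Real.exp (-x))

lemma stdExpLaw_Ioi {a : ℝ} (ha : 0 ≤ a) : stdExpLaw (Ioi a) = ENNReal.ofReal (Real.exp (-a)) := by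
  rw [stdExpLaw, withDensity_apply _ measurableSet_Ioi, Measure.restrict_restrict measurableSet_Ioi,
    inter_eq_left.2 (Ioi_subset_Ioi ha), ← integral_exp_neg_Ioi,
    ofReal_integral_eq_lintegral_ofReal (integrableOn_exp_neg_Ioi a)
      (ae_of_all _ fun x => (Real.exp_pos _).le)]

lemma ae_pos_stdExpLaw : ∀ᵐ x ∂stdExpLaw, 0 < x :=
  (withDensity_absolutelyContinuous _ _).ae_le (ae_restrict_mem measurableSet_Ioi)

instance : IsProbabilityMeasure stdExpLaw where
  measure_univ := by
    have h : Ioi (0 : ℝ) =ᵐ[stdExpLaw] univ := by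
      filter_upwards [ae_pos_stdExpLaw] with x hx
      exact propext ⟨fun _ => trivial, fun _ => hx⟩
    rw [← measure_congr h, stdExpLaw_Ioi le_rfl]
    simp

lemma integrable_exp_mul_log_stdExpLaw {r : ℝ} (hr : -1 < r) :
    Integrable (fun x => Real.exp (r * Real.log x)) stdExpLaw ∧
      ∫ x, Real.exp (r * Real.log x) ∂stdExpLaw = Real.Gamma (r + 1) := by
  have hm : Measurable fun x : ℝ => ENNReal.ofReal (Real.exp (-x)) := by fun_prop
  have hfin : ∀ᵐ x ∂(volume.restrict (Ioi (0 : ℝ))), ENNReal.ofReal (Real.exp (-x)) < ⊤ :=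
    ae_of_all _ fun x => ENNReal.ofReal_lt_top
  have hpt : ∀ x ∈ Ioi (0 : ℝ), Real.exp (-x) * x ^ (r + 1 - 1) =
      (ENNReal.ofReal (Real.exp (-x))).toReal • Real.exp (r * Real.log x) := by
    intro x hx
    rw [ENNReal.toReal_ofReal (Real.exp_pos _).le, add_sub_cancel_right, Real.rpow_def_of_pos hx,
      smul_eq_mul, mul_comm r]
  constructor
  · rw [stdExpLaw, integrable_withDensity_iff_integrable_smul' hm hfin]
    exact (integrableOn_congr_fun hpt measurableSet_Ioi).1
      (Real.GammaIntegral_convergent (by linarith))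
  · rw [stdExpLaw, integral_withDensity_eq_integral_toReal_smul hm hfin,
      Real.Gamma_eq_integral (by linarith)]
    exact (setIntegral_congr_fun measurableSet_Ioi hpt).symm

/-- A law on `(0, ∞)` whose negative moments near `0` are those of the positive stable law has the
Laplace transform of the positive stable law. -/
lemma isPositiveStableLaw_of_moments {α : ℝ} (hα0 : 0 < α) (hα1 : α < 1) {ν : Measure ℝ}
    [IsProbabilityMeasure ν] (hν : ν (Iic 0) = 0)
    (hint : ∀ s ∈ Ioo (-α) α, Integrable (fun x => Real.exp (-s * Real.log x)) ν)
    (hmom : ∀ s ∈ Ioo (-α) α, ∫ x, Real.exp (-s * Real.log x) ∂ν =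
      Real.Gamma (s / α + 1) / Real.Gamma (s + 1)) :
    IsPositiveStableLaw α ν := by
  refine ⟨inferInstance, hν, fun l hl => ?_⟩
  rcases hl.eq_or_lt with rfl | hl
  · simp [Real.zero_rpow hα0.ne']
  have hpos : ∀ᵐ x ∂ν, 0 < x := by
    rw [ae_iff]
    simpa [Iic_def] using hν
  -- The logarithm of `(E / X) ^ α`. Its transform at `t` is `Γ(t + 1) / Γ(α t + 1) * Γ(α t + 1)`,
  -- that of `log E`.
  set Z : ℝ × ℝ → ℝ := fun q => α * (Real.log q.2 - Real.log q.1) with hZ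
  have hZm : Measurable Z := by fun_prop
  have hαt {t : ℝ} (ht : t ∈ Ioo (-1 : ℝ) 1) : α * t ∈ Ioo (-α) α :=
    ⟨by nlinarith [ht.1], by nlinarith [ht.2]⟩
  have hexp (t : ℝ) (q : ℝ × ℝ) : Real.exp (t * Z q) =
      Real.exp (-(α * t) * Real.log q.1) * Real.exp (α * t * Real.log q.2) := by
    rw [← Real.exp_add]
    congr 1
    simp only [hZ]
    ring
  have hlaw : (ν.prod stdExpLaw).map Z = stdExpLaw.map Real.log := by
    refine map_eq_of_mgf_eq_near_zero hZm.aemeasurable Real.measurable_log.aemeasurable one_pos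
      (fun t ht => ?_) (fun t ht => (integrable_exp_mul_log_stdExpLaw ht.1).1) fun t ht => ?_
    · simp_rw [hexp]
      exact (hint _ (hαt ht)).mul_prod
        (integrable_exp_mul_log_stdExpLaw (by linarith [(hαt ht).1])).1
    · rw [mgf, mgf, (integrable_exp_mul_log_stdExpLaw ht.1).2]
      simp_rw [hexp]
      rw [integral_prod_mul (fun x => Real.exp (-(α * t) * Real.log x))
        (fun x => Real.exp (α * t * Real.log x)), hmom _ (hαt ht),
        (integrable_exp_mul_log_stdExpLaw (by linarith [(hαt ht).1])).2,
        div_mul_cancel₀ _ (Real.Gamma_pos_of_pos (by linarith [(hαt ht).1])).ne',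
        mul_div_cancel_left₀ _ hα0.ne']
  -- Equal tails at `α log l`: one side is `P(E > l X)`, the other `P(E > l ^ α)`.
  have h1 := congrArg (fun m : Measure ℝ => m (Ioi (α * Real.log l))) hlaw
  have hset : MeasurableSet (Z ⁻¹' Ioi (α * Real.log l)) := hZm measurableSet_Ioi
  rw [Measure.map_apply hZm measurableSet_Ioi, Measure.map_apply Real.measurable_log
    measurableSet_Ioi, Measure.prod_apply hset] at h1
  have hright : stdExpLaw (Real.log ⁻¹' Ioi (α * Real.log l)) =
      ENNReal.ofReal (Real.exp (-l ^ α)) := by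
    rw [← stdExpLaw_Ioi (by positivity)]
    refine measure_congr ?_
    filter_upwards [ae_pos_stdExpLaw] with x hx
    refine propext ?_
    change α * Real.log l < Real.log x ↔ l ^ α < x
    rw [← Real.log_rpow hl, Real.log_lt_log_iff (by positivity) hx]
  have hleft : ∀ᵐ x ∂ν, stdExpLaw (Prod.mk x ⁻¹' (Z ⁻¹' Ioi (α * Real.log l))) =
      ENNReal.ofReal (Real.exp (-(l * x))) := by
    filter_upwards [hpos] with x hx
    rw [← stdExpLaw_Ioi (by positivity)]
    refine measure_congr ?_
    filter_upwards [ae_pos_stdExpLaw] with e he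
    refine propext ?_
    change α * Real.log l < α * (Real.log e - Real.log x) ↔ l * x < e
    rw [mul_lt_mul_iff_right₀ hα0, lt_sub_iff_add_lt, ← Real.log_mul hl.ne' hx.ne',
      Real.log_lt_log_iff (by positivity) he]
  rw [lintegral_congr_ae hleft, hright] at h1
  rw [integral_eq_lintegral_of_nonneg_ae (ae_of_all _ fun x => (Real.exp_pos _).le)
    (by fun_prop), h1, ENNReal.toReal_ofReal (Real.exp_pos _).le]

/-! ### The logarithm of a beta variable -/

lemma integral_betaMeasure_exp_mul_log {a b s : ℝ} (ha : 0 < a) (hb : 0 < b) (hbs : 0 < b + s) :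
    Integrable (fun x => Real.exp (s * Real.log (1 - x))) (betaMeasure a b) ∧
      ∫ x, Real.exp (s * Real.log (1 - x)) ∂betaMeasure a b =
        Real.Gamma (b + s) * Real.Gamma (a + b) / (Real.Gamma (a + b + s) * Real.Gamma b) := by
  have hlin : ∫⁻ x, ENNReal.ofReal (Real.exp (s * Real.log (1 - x))) ∂betaMeasure a b =
      ENNReal.ofReal (beta a (b + s) / beta a b) := by
    rw [← lintegral_betaMeasure_rpow ha hb hbs]
    refine lintegral_congr_ae ?_
    filter_upwards [ae_mem_Ioo_betaMeasure a b] with x hx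
    rw [Real.rpow_def_of_pos (by linarith [hx.2]), mul_comm]
  have hm : Measurable fun x : ℝ => Real.exp (s * Real.log (1 - x)) := by fun_prop
  have h0 : 0 ≤ᵐ[betaMeasure a b] fun x : ℝ => Real.exp (s * Real.log (1 - x)) :=
    ae_of_all _ fun x => (Real.exp_pos _).le
  refine ⟨⟨hm.aestronglyMeasurable, ?_⟩, ?_⟩
  · rw [hasFiniteIntegral_iff_ofReal h0, hlin]
    exact ENNReal.ofReal_lt_top
  · rw [integral_eq_lintegral_of_nonneg_ae h0 hm.aestronglyMeasurable, hlin,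
      ENNReal.toReal_ofReal (div_nonneg (beta_pos ha hbs).le (beta_pos ha hb).le),
      beta_add_div_beta ha]

lemma map_neg_log_one_sub_betaMeasure_absolutelyContinuous (a b : ℝ) :
    (betaMeasure a b).map (fun x => -Real.log (1 - x)) ≪ volume := by
  refine map_absolutelyContinuous_of_leftInverse (withDensity_absolutelyContinuous _ _)
    (h := fun y => 1 - Real.exp (-y)) (D := univ) (by fun_prop) (by fun_prop) ?_
  filter_upwards [ae_mem_Ioo_betaMeasure a b] with x hx
  refine ⟨trivial, ?_⟩
  rw [neg_neg, Real.exp_log (by linarith [hx.2])]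
  ring

/-! ### Exponential moments of the renewal epochs -/

/-- `E (1 - V) ^ s` for `V` with the law `beta (1 - α, θ + (i + 1) α)`. -/
noncomputable def stepMoment (α θ s : ℝ) (i : ℕ) : ℝ :=
  Real.Gamma (θ + ((i : ℝ) + 1) * α + s) * Real.Gamma (1 - α + (θ + ((i : ℝ) + 1) * α)) /
    (Real.Gamma (1 - α + (θ + ((i : ℝ) + 1) * α) + s) * Real.Gamma (θ + ((i : ℝ) + 1) * α))

/-- The moment of order `-s` of the polynomially tilted positive stable law. -/
noncomputable def tiltedStableMoment (α θ s : ℝ) : ℝ :=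
  Real.Gamma (θ + 1) / Real.Gamma (θ + s + 1) *
    (Real.Gamma ((θ + s) / α + 1) / Real.Gamma (θ / α + 1))

lemma tiltedStableMoment_pos {α θ s : ℝ} (hα0 : 0 < α) (hα1 : α < 1) (hθ : -α < θ)
    (hs : -α < θ + s) : 0 < tiltedStableMoment α θ s := by
  have h1 : 0 < Real.Gamma (θ + 1) := Real.Gamma_pos_of_pos (by linarith)
  have h2 : 0 < Real.Gamma (θ + s + 1) := Real.Gamma_pos_of_pos (by linarith)
  have hdiv {x : ℝ} (hx : -α < x) : 0 < x / α + 1 := by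
    rw [div_add_one hα0.ne']
    exact div_pos (by linarith) hα0
  have h3 : 0 < Real.Gamma ((θ + s) / α + 1) := Real.Gamma_pos_of_pos (hdiv hs)
  have h4 : 0 < Real.Gamma (θ / α + 1) := Real.Gamma_pos_of_pos (hdiv hθ)
  unfold tiltedStableMoment
  positivity

/-- Each step brings in `Γ(θ + i α + 1)`, which for `i ≥ 1` is `(θ + i α) Γ(θ + i α)`. The Gamma
factors cancel against the previous step, and the linear factors, divided by `α`, build up the Gamma
values at `θ / α` and `(θ + s) / α`. At `i = 0` the value `Γ(θ + 1)` stays whole, since `θ` may be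
zero or negative. -/
lemma prod_stepMoment {α θ s : ℝ} (hα0 : 0 < α) (hα1 : α < 1) (hθ : -α < θ) (hs : -α < θ + s)
    (n : ℕ) : ∏ i ∈ Finset.range (n + 1), stepMoment α θ s i =
      tiltedStableMoment α θ s *
        (Real.Gamma (((n : ℝ) + 1) * α + (θ + s)) / Real.Gamma (((n : ℝ) + 1) * α + θ)) *
        (Real.Gamma ((n : ℝ) + 1 + θ / α) / Real.Gamma ((n : ℝ) + 1 + (θ + s) / α)) := by
  have hdiv {x : ℝ} (hx : -α < x) : -1 < x / α := by
    rw [lt_div_iff₀ hα0]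
    linarith
  have d1 := hdiv hθ
  have d2 := hdiv hs
  have g1 : Real.Gamma (θ + 1) ≠ 0 := (Real.Gamma_pos_of_pos (by linarith)).ne'
  have g2 : Real.Gamma (θ + s + 1) ≠ 0 := (Real.Gamma_pos_of_pos (by linarith)).ne'
  induction n with
  | zero =>
    have g3 : Real.Gamma ((θ + s) / α + 1) ≠ 0 := (Real.Gamma_pos_of_pos (by linarith)).ne'
    have g4 : Real.Gamma (θ / α + 1) ≠ 0 := (Real.Gamma_pos_of_pos (by linarith)).ne'
    have g5 : Real.Gamma (α + θ) ≠ 0 := (Real.Gamma_pos_of_pos (by linarith)).ne'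
    simp only [zero_add, Finset.range_one, Finset.prod_singleton, stepMoment, tiltedStableMoment,
      Nat.cast_zero, one_mul]
    rw [show 1 - α + (θ + α) = θ + 1 by ring, show θ + 1 + s = θ + s + 1 by ring,
      show θ + α + s = α + (θ + s) by ring, add_comm θ α, add_comm (1 : ℝ), add_comm (1 : ℝ)]
    generalize Real.Gamma ((θ + s) / α + 1) = A at *
    generalize Real.Gamma (θ / α + 1) = B at *
    field_simp
  | succ n ih =>
    have hn : (0 : ℝ) ≤ n := n.cast_nonneg
    have hnα : 0 ≤ (n : ℝ) * α := by positivity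
    have p1 : 0 < ((n : ℝ) + 1) * α + θ := by nlinarith
    have p2 : 0 < ((n : ℝ) + 1) * α + (θ + s) := by nlinarith
    have p3 : 0 < (n : ℝ) + 1 + θ / α := by linarith
    have p4 : 0 < (n : ℝ) + 1 + (θ + s) / α := by linarith
    rw [Finset.prod_range_succ, ih, stepMoment]
    push_cast
    rw [show 1 - α + (θ + ((n : ℝ) + 1 + 1) * α) = ((n : ℝ) + 1) * α + θ + 1 by ring,
      show ((n : ℝ) + 1) * α + θ + 1 + s = ((n : ℝ) + 1) * α + (θ + s) + 1 by ring,
      show θ + ((n : ℝ) + 1 + 1) * α + s = ((n : ℝ) + 1 + 1) * α + (θ + s) by ring,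
      show θ + ((n : ℝ) + 1 + 1) * α = ((n : ℝ) + 1 + 1) * α + θ by ring,
      show (n : ℝ) + 1 + 1 + θ / α = (n : ℝ) + 1 + θ / α + 1 by ring,
      show (n : ℝ) + 1 + 1 + (θ + s) / α = (n : ℝ) + 1 + (θ + s) / α + 1 by ring,
      Real.Gamma_add_one p1.ne', Real.Gamma_add_one p2.ne', Real.Gamma_add_one p3.ne',
      Real.Gamma_add_one p4.ne']
    have q1 := (Real.Gamma_pos_of_pos p1).ne'
    have q2 := (Real.Gamma_pos_of_pos p2).ne'
    have q3 := (Real.Gamma_pos_of_pos p3).ne'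
    have q4 := (Real.Gamma_pos_of_pos p4).ne'
    have e1 : ((n : ℝ) + 1) * α + θ = α * ((n : ℝ) + 1 + θ / α) := by field_simp
    have e2 : ((n : ℝ) + 1) * α + (θ + s) = α * ((n : ℝ) + 1 + (θ + s) / α) := by field_simp
    have q5 : Real.Gamma (((n : ℝ) + 1 + 1) * α + θ) ≠ 0 :=
      (Real.Gamma_pos_of_pos (by nlinarith)).ne'
    generalize hA : Real.Gamma (((n : ℝ) + 1) * α + θ) = A at *
    generalize hB : Real.Gamma (((n : ℝ) + 1) * α + (θ + s)) = B at *
    rw [e1, e2]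
    generalize (n : ℝ) + 1 + θ / α = x at *
    generalize (n : ℝ) + 1 + (θ + s) / α = z at *
    have hx := p3.ne'
    have hz := p4.ne'
    field_simp

lemma tendsto_Gamma_div_Gamma_mul_rpow (a b : ℝ) :
    Tendsto (fun x : ℝ => Real.Gamma (x + a) / Real.Gamma (x + b) * x ^ (b - a)) atTop (𝓝 1) := by
  have h := (tendsto_Gamma_add_div a).div (tendsto_Gamma_add_div b) one_ne_zero
  rw [div_one] at h
  refine h.congr' ?_
  filter_upwards [eventually_gt_atTop 0] with x hx
  have h1 := (Real.Gamma_pos_of_pos hx).ne'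
  have h2 : 0 < x ^ a := by positivity
  have h3 : 0 < x ^ b := by positivity
  rw [Pi.div_apply, Real.rpow_sub hx]
  field_simp

lemma tendsto_rpow_mul_prod_stepMoment {α θ s : ℝ} (hα0 : 0 < α) (hα1 : α < 1) (hθ : -α < θ)
    (hs : -α < θ + s) :
    Tendsto (fun n : ℕ => Real.exp (-s * (Real.log α - (1 / α - 1) * Real.log ((n : ℝ) + 1))) *
      ∏ i ∈ Finset.range (n + 1), stepMoment α θ s i) atTop (𝓝 (tiltedStableMoment α θ s)) := by
  have hn : Tendsto (fun n : ℕ => (n : ℝ) + 1) atTop atTop :=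
    tendsto_atTop_add_const_right _ _ tendsto_natCast_atTop_atTop
  have h1 := (tendsto_Gamma_div_Gamma_mul_rpow (θ + s) θ).comp (hn.atTop_mul_const hα0)
  have h2 := (tendsto_Gamma_div_Gamma_mul_rpow (θ / α) ((θ + s) / α)).comp hn
  have h3 := (h1.mul h2).const_mul (tiltedStableMoment α θ s)
  simp only [mul_one] at h3
  refine h3.congr fun n => ?_
  have hn0 : (0 : ℝ) < (n : ℝ) + 1 := by positivity
  simp only [Function.comp_apply]
  rw [prod_stepMoment hα0 hα1 hθ hs]
  -- The two powers combine to `α ^ (-s) (n + 1) ^ (s (1 / α - 1))`: this fixes the centring.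
  have e : Real.exp (-s * (Real.log α - (1 / α - 1) * Real.log ((n : ℝ) + 1))) =
      (((n : ℝ) + 1) * α) ^ (θ - (θ + s)) * ((n : ℝ) + 1) ^ ((θ + s) / α - θ / α) := by
    rw [Real.rpow_def_of_pos (by positivity), Real.rpow_def_of_pos hn0, ← Real.exp_add,
      Real.log_mul hn0.ne' hα0.ne']
    congr 1
    field_simp
    ring
  rw [e]
  ring

/-! ### Convergence of the centred renewal epochs -/

/-- The `(n + 1)`-st partial sum of `ξ`, centred by its asymptotic logarithmic growth. -/
noncomputable def centredSum {Ω : Type*} (α : ℝ) (ξ : ℕ → Ω → ℝ) (n : ℕ) (ω : Ω) : ℝ :=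
  ∑ i ∈ Finset.range (n + 1), ξ i ω + (Real.log α - (1 / α - 1) * Real.log ((n : ℝ) + 1))

lemma exp_mul_centredSum {Ω : Type*} (α : ℝ) (ξ : ℕ → Ω → ℝ) (s : ℝ) (n : ℕ) (ω : Ω) : Real.exp (-s * centredSum α ξ n ω) =
    Real.exp (-s * (Real.log α - (1 / α - 1) * Real.log ((n : ℝ) + 1))) *
      Real.exp (-s * ∑ i ∈ Finset.range (n + 1), ξ i ω) := by
  rw [centredSum, ← Real.exp_add]
  congr 1
  ring

section Walk

variable {Ω : Type*} [MeasurableSpace Ω] {P : Measure Ω} [IsProbabilityMeasure P] {α θ : ℝ}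
  {ξ : ℕ → Ω → ℝ}

lemma mgf_centredSum (hξ : ∀ i, Measurable (ξ i)) (hind : iIndepFun ξ P) {s : ℝ}
    (hint : ∀ i, Integrable (fun ω => Real.exp (-s * ξ i ω)) P)
    (hmgf : ∀ i, mgf (ξ i) P (-s) = stepMoment α θ s i) (n : ℕ) :
    Integrable (fun ω => Real.exp (-s * centredSum α ξ n ω)) P ∧
      mgf (centredSum α ξ n) P (-s) =
        Real.exp (-s * (Real.log α - (1 / α - 1) * Real.log ((n : ℝ) + 1))) *
          ∏ i ∈ Finset.range (n + 1), stepMoment α θ s i := by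
  have h1 := hind.integrable_exp_mul_sum hξ (s := Finset.range (n + 1)) (t := -s) fun i _ => hint i
  have h2 := hind.mgf_sum hξ (Finset.range (n + 1)) (t := -s)
  simp only [Finset.sum_apply] at h1
  simp only [hmgf] at h2
  simp only [mgf, Finset.sum_apply] at h2
  constructor
  · simp_rw [exp_mul_centredSum]
    exact h1.const_mul _
  · rw [mgf]
    simp_rw [exp_mul_centredSum]
    rw [integral_const_mul, h2]

/-- A single exponent would not exclude the limit `0` of the exponential. With `δ` and `-δ` the two
limits have product 1, so logarithms may be taken. -/
lemma ae_exists_tendsto_centredSum (hα0 : 0 < α) (hα1 : α < 1) (hθ : -α < θ)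
    (hξ : ∀ i, Measurable (ξ i)) (hind : iIndepFun ξ P)
    (hint : ∀ s, -α < θ + s → ∀ i, Integrable (fun ω => Real.exp (-s * ξ i ω)) P)
    (hmgf : ∀ s, -α < θ + s → ∀ i, mgf (ξ i) P (-s) = stepMoment α θ s i) :
    ∀ᵐ ω ∂P, ∃ y, Tendsto (fun n => centredSum α ξ n ω) atTop (𝓝 y) := by
  have key (s : ℝ) (hs : -α < θ + s) :
      ∀ᵐ ω ∂P, ∃ y, Tendsto (fun n => Real.exp (-s * centredSum α ξ n ω)) atTop (𝓝 y) := by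
    filter_upwards [ae_exists_tendsto_exp_sum_div hξ hind (hint s hs)] with ω ⟨c, hc⟩
    refine ⟨_, ((tendsto_rpow_mul_prod_stepMoment hα0 hα1 hθ hs).mul
      ((tendsto_add_atTop_iff_nat 1).2 hc)).congr fun n => ?_⟩
    have hne : ∏ i ∈ Finset.range (n + 1), stepMoment α θ s i ≠ 0 :=
      (Finset.prod_pos fun i _ => hmgf s hs i ▸ mgf_pos (hint s hs i)).ne'
    simp_rw [hmgf s hs]
    rw [exp_mul_centredSum]
    field_simp
  -- Half the distance from `θ` to `-α`, so both `δ` and `-δ` are admissible exponents.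
  set δ : ℝ := (θ + α) / 2 with hδ
  have hδ0 : 0 < δ := by linarith
  filter_upwards [key δ (by linarith), key (-δ) (by linarith)] with ω ⟨a, ha⟩ ⟨b, hb⟩
  have hab : a * b = 1 := by
    refine tendsto_nhds_unique (ha.mul hb) (tendsto_const_nhds.congr fun n => ?_)
    rw [← Real.exp_add]
    simp
  have hb0 : b ≠ 0 := right_ne_zero_of_mul_eq_one hab
  refine ⟨Real.log b / δ, (((Real.continuousAt_log hb0).tendsto.comp hb).div_const δ).congr
    fun n => ?_⟩
  simp only [Function.comp_apply, neg_neg, Real.log_exp]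
  field_simp

lemma exists_limit_centredSum (hα0 : 0 < α) (hα1 : α < 1) (hθ : -α < θ)
    (hξ : ∀ i, Measurable (ξ i)) (hind : iIndepFun ξ P) (hac : P.map (ξ 0) ≪ volume)
    (hint : ∀ s, -α < θ + s → ∀ i, Integrable (fun ω => Real.exp (-s * ξ i ω)) P)
    (hmgf : ∀ s, -α < θ + s → ∀ i, mgf (ξ i) P (-s) = stepMoment α θ s i) :
    ∃ Y : Ω → ℝ, Measurable Y ∧ P.map Y ≪ volume ∧
      (∀ᵐ ω ∂P, Tendsto (fun n => centredSum α ξ n ω) atTop (𝓝 (Y ω))) ∧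
      ∀ s, -α < θ + s → Integrable (fun ω => Real.exp (-s * Y ω)) P ∧
        ∫ ω, Real.exp (-s * Y ω) ∂P = tiltedStableMoment α θ s := by
  -- The limit without its first step. As a limsup it is measurable with respect to `ξ 1, ξ 2, …`,
  -- hence independent of `ξ 0`, and the law of `ξ 0 + R` is a convolution with an absolutely
  -- continuous law.
  set R : Ω → ℝ := fun ω => limsup (fun n : ℕ => ∑ i ∈ Finset.range n, ξ (i + 1) ω +
    (Real.log α - (1 / α - 1) * Real.log ((n : ℝ) + 1))) atTop with hR
  have hmle : ⨆ i ∈ Ioi (0 : ℕ), MeasurableSpace.comap (ξ i) inferInstance ≤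
      ‹MeasurableSpace Ω› := iSup₂_le fun i _ => (hξ i).comap_le
  have hRm' : Measurable[⨆ i ∈ Ioi (0 : ℕ), MeasurableSpace.comap (ξ i) inferInstance] R := by
    refine Measurable.limsup fun n => Measurable.add_const
      (Finset.measurable_fun_sum _ fun i _ => ?_) _
    exact (comap_measurable (ξ (i + 1))).mono
      (le_iSup₂ (f := fun i (_ : i ∈ Ioi 0) => MeasurableSpace.comap (ξ i) inferInstance) (i + 1)
        (Nat.succ_pos i)) le_rfl
  have hRm : Measurable R := hRm'.mono hmle le_rfl
  have hindR : ξ 0 ⟂ᵢ[P] R := by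
    have h := indep_iSup_of_disjoint (fun i => (hξ i).comap_le) hind
      (S := {0}) (T := Ioi 0) (by simp)
    rw [iSup_singleton] at h
    exact indep_of_indep_of_le_right h hRm'.comap_le
  have hYm : Measurable (ξ 0 + R) := (hξ 0).add hRm
  have hlim : ∀ᵐ ω ∂P, Tendsto (fun n => centredSum α ξ n ω) atTop (𝓝 ((ξ 0 + R) ω)) := by
    filter_upwards [ae_exists_tendsto_centredSum hα0 hα1 hθ hξ hind hint hmgf] with ω ⟨y, hy⟩
    have hR' : R ω = y - ξ 0 ω := by
      refine Tendsto.limsup_eq ((hy.sub_const (ξ 0 ω)).congr fun n => ?_)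
      rw [centredSum, Finset.sum_range_succ']
      ring
    rw [Pi.add_apply, hR', add_sub_cancel]
    exact hy
  refine ⟨ξ 0 + R, hYm, ?_, hlim, fun s hs => ?_⟩
  · rw [hindR.map_add_eq_map_conv_map (hξ 0) hRm, Measure.conv_comm]
    exact Measure.conv_absolutelyContinuous hac
  -- The admissible range of exponents is open, which leaves room for the higher moment that gives
  -- uniform integrability.
  · obtain ⟨p, hp1, hp⟩ : ∃ p : ℝ, 1 < p ∧ -α < θ + p * s := by
      have hcont : Tendsto (fun p : ℝ => θ + p * s) (𝓝[>] 1) (𝓝 (θ + 1 * s)) :=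
        ((continuous_const.add (continuous_id.mul continuous_const)).tendsto 1).mono_left
          nhdsWithin_le_nhds
      rw [one_mul] at hcont
      obtain ⟨p, h1, h2⟩ := ((hcont.eventually_const_lt hs).and self_mem_nhdsWithin).exists
      exact ⟨p, h2, h1⟩
    have hmp := mgf_centredSum (α := α) hξ hind (hint _ hp) (hmgf _ hp)
    have hms := mgf_centredSum (α := α) hξ hind (hint _ hs) (hmgf _ hs)
    obtain ⟨C, hC⟩ := (tendsto_rpow_mul_prod_stepMoment hα0 hα1 hθ hp).bddAbove_range
    refine mgf_eq_of_ae_tendsto (Y := centredSum α ξ) (p := p) (C := C) (fun n => ?_) hlim hp1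
      (fun n => ?_) (fun n => ?_) ?_
    · exact ((Finset.measurable_fun_sum _ fun i _ => hξ i).add_const _).aemeasurable
    · simpa only [mul_neg] using (neg_mul p s ▸ (hmp n).1)
    · rw [mul_neg, (hmp n).2]
      exact hC ⟨n, rfl⟩
    · simp_rw [fun n => (hms n).2]
      exact tendsto_rpow_mul_prod_stepMoment hα0 hα1 hθ hs

end Walk

/-! ### Identification of the limit law -/

lemma isTiltedStableLaw_map_exp {Ω : Type*} [MeasurableSpace Ω] {P : Measure Ω}
    [IsProbabilityMeasure P] {α θ : ℝ} (hα0 : 0 < α) (hα1 : α < 1) (hθ : -α < θ) {Y : Ω → ℝ}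
    (hY : Measurable Y) (hac : P.map Y ≪ volume)
    (hmom : ∀ s, -α < θ + s → Integrable (fun ω => Real.exp (-s * Y ω)) P ∧
      ∫ ω, Real.exp (-s * Y ω) ∂P = tiltedStableMoment α θ s) :
    IsTiltedStableLaw α θ (P.map fun ω => Real.exp (Y ω)) := by
  have hTm : Measurable fun ω => Real.exp (Y ω) := hY.exp
  set μ := P.map fun ω => Real.exp (Y ω) with hμ
  have : IsProbabilityMeasure μ := Measure.isProbabilityMeasure_map hTm.aemeasurable
  have hμac : μ ≪ volume := by
    have h : μ = (P.map Y).map Real.exp := (Measure.map_map Real.measurable_exp hY).symm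
    rw [h]
    refine map_absolutelyContinuous_of_leftInverse hac Real.measurable_exp
      (h := Real.log) (D := Ioi 0) (fun x hx => ?_) (ae_of_all _ fun x => ?_)
    · exact (Real.differentiableAt_log (ne_of_gt hx)).differentiableWithinAt
    · exact ⟨Real.exp_pos x, Real.log_exp x⟩
  have hμpos : ∀ᵐ x ∂μ, 0 < x := by
    rw [hμ, ae_map_iff hTm.aemeasurable measurableSet_Ioi]
    exact ae_of_all _ fun ω => Real.exp_pos _
  set g : ℝ → ℝ := fun t => (μ.rnDeriv volume t).toReal with hg
  have hgm : Measurable g := (Measure.measurable_rnDeriv μ volume).ennreal_toReal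
  have hμg : μ = (volume.restrict (Ioi 0)).withDensity fun t => ENNReal.ofReal (g t) := by
    have h1 : volume.withDensity (fun t => ENNReal.ofReal (g t)) = μ := by
      rw [← Measure.withDensity_rnDeriv_eq μ volume hμac]
      refine withDensity_congr_ae ?_
      filter_upwards [Measure.rnDeriv_lt_top μ volume] with t ht
      exact ENNReal.ofReal_toReal ht.ne
    rw [← restrict_withDensity measurableSet_Ioi, h1]
    exact (Measure.restrict_eq_self_of_ae_mem hμpos).symm
  have hdiv : 0 < θ / α + 1 := by
    rw [div_add_one hα0.ne']
    exact div_pos (by linarith) hα0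
  have hG1 : 0 < Real.Gamma (θ + 1) := Real.Gamma_pos_of_pos (by linarith)
  have hG2 : 0 < Real.Gamma (θ / α + 1) := Real.Gamma_pos_of_pos hdiv
  set C : ℝ := Real.Gamma (θ / α + 1) / Real.Gamma (θ + 1) with hC
  have hC0 : 0 < C := div_pos hG2 hG1
  have hCmom (s : ℝ) : C * tiltedStableMoment α θ (s - θ) =
      Real.Gamma (s / α + 1) / Real.Gamma (s + 1) := by
    rw [hC, tiltedStableMoment, add_sub_cancel]
    generalize Real.Gamma (θ / α + 1) = A at *
    generalize Real.Gamma (s / α + 1) = B at *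
    field_simp
  -- The untilted density. Its moment of order `-s` is `C` times the moment of `T` of order `-(s -
  -- θ)`.
  set f : ℝ → ℝ := fun t => C * t ^ θ * g t with hf
  have hfm : Measurable f := by fun_prop
  have hden : Measurable fun t : ℝ => ENNReal.ofReal (C * t ^ θ) := by fun_prop
  set ν := (volume.restrict (Ioi 0)).withDensity fun t => ENNReal.ofReal (f t) with hν
  have hνμ : ν = μ.withDensity fun t => ENNReal.ofReal (C * t ^ θ) := by
    rw [hμg, ← withDensity_mul _ hgm.ennreal_ofReal hden, hν]
    refine withDensity_congr_ae ?_
    filter_upwards [ae_restrict_mem measurableSet_Ioi] with t ht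
    have ht' : (0 : ℝ) < t := ht
    rw [Pi.mul_apply, ← ENNReal.ofReal_mul ENNReal.toReal_nonneg, hf, mul_comm]
  have hpow (s : ℝ) (ω : Ω) : C * Real.exp (Y ω) ^ θ * Real.exp (-s * Real.log (Real.exp (Y ω))) =
      C * Real.exp (-(s - θ) * Y ω) := by
    rw [← Real.exp_mul, Real.log_exp, mul_assoc, ← Real.exp_add]
    congr 2
    ring
  have hmom' (s : ℝ) (hs : s ∈ Ioo (-α) α) :
      Integrable (fun x => Real.exp (-s * Real.log x)) ν ∧
        ∫ x, Real.exp (-s * Real.log x) ∂ν = Real.Gamma (s / α + 1) / Real.Gamma (s + 1) := by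
    have hs' := hmom (s - θ) (by linarith [hs.1])
    have hfin : ∀ᵐ t ∂μ, ENNReal.ofReal (C * t ^ θ) < ⊤ :=
      ae_of_all _ fun t => ENNReal.ofReal_lt_top
    have hpt : (fun t => (ENNReal.ofReal (C * t ^ θ)).toReal • Real.exp (-s * Real.log t)) =ᵐ[μ]
        fun t => C * t ^ θ * Real.exp (-s * Real.log t) := by
      filter_upwards [hμpos] with t ht
      rw [ENNReal.toReal_ofReal (by positivity), smul_eq_mul]
    have hm : Measurable fun t : ℝ => C * t ^ θ * Real.exp (-s * Real.log t) := by fun_prop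
    rw [hνμ]
    constructor
    · rw [integrable_withDensity_iff_integrable_smul' hden hfin, integrable_congr hpt, hμ,
        integrable_map_measure hm.aestronglyMeasurable hTm.aemeasurable]
      exact (hs'.1.const_mul C).congr (ae_of_all _ fun ω => (hpow s ω).symm)
    · rw [integral_withDensity_eq_integral_toReal_smul hden hfin, integral_congr_ae hpt, hμ,
        integral_map hTm.aemeasurable hm.aestronglyMeasurable]
      simp_rw [hpow]
      rw [integral_const_mul, hs'.2, hCmom]
  -- The moment at `s = 0` is the total mass; the real value 1 also excludes infinite mass.
  have hνprob : IsProbabilityMeasure ν := by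
    have h := hmom' 0 ⟨by linarith, hα0⟩
    simp only [neg_zero, zero_mul, Real.exp_zero, integral_const, smul_eq_mul, mul_one,
      zero_div, zero_add, Real.Gamma_one, div_one] at h
    refine ⟨?_⟩
    rw [← ENNReal.toReal_eq_one_iff]
    exact h.2
  have hν0 : ν (Iic 0) = 0 := by
    have h : ν ≪ volume.restrict (Ioi 0) := withDensity_absolutelyContinuous _ _
    refine h ?_
    rw [Measure.restrict_apply measurableSet_Iic, Iic_inter_Ioi, Ioc_self, measure_empty]
  refine ⟨f, ⟨hfm, fun t ht => ?_, ?_⟩, ?_⟩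
  · exact mul_nonneg (by positivity) ENNReal.toReal_nonneg
  · exact isPositiveStableLaw_of_moments hα0 hα1 hν0 (fun s hs => (hmom' s hs).1)
      fun s hs => (hmom' s hs).2
  · rw [hμg]
    refine withDensity_congr_ae ?_
    filter_upwards [ae_restrict_mem measurableSet_Ioi] with t ht
    have ht' : (0 : ℝ) < t := ht
    have htθ : t ^ (-θ) * t ^ θ = 1 := by rw [← Real.rpow_add ht']; simp
    have : tiltedDensity α θ f t = g t := by
      calc tiltedDensity α θ f t = (Real.Gamma (θ + 1) / Real.Gamma (θ / α + 1) * C) *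
            (t ^ (-θ) * t ^ θ) * g t := by
              simp only [tiltedDensity, hf]
              ring
        _ = g t := by
              rw [htθ, mul_one, hC, div_mul_div_cancel₀ hG2.ne', div_self hG1.ne', one_mul]
    rw [this]

theorem theorem1 {Ω : Type*} [MeasurableSpace Ω] (P : Measure Ω) [IsProbabilityMeasure P]
    (α θ : ℝ) (hα0 : 0 < α) (hα1 : α < 1) (hθ : -α < θ)
    (V : ℕ → Ω → ℝ)
    (hlaw : ∀ i : ℕ, HasLaw (V i) (betaMeasure (1 - α) (θ + ((i : ℝ) + 1) * α)) P)
    (hindep : iIndepFun V P) :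
    (∀ᵐ ω ∂P, ∀ t : ℝ, 0 ≤ t →
      IsGreatest {n : ℕ | renewalEpoch V n ω ≤ t} (renewalCount V t ω)) ∧
    ∃ T : Ω → ℝ, Measurable T ∧ (∀ ω, 0 < T ω) ∧ IsTiltedStableLaw α θ (P.map T) ∧
      ∀ᵐ ω ∂P, Tendsto
        (fun t : ℝ => t - (1 / α - 1) * Real.log (renewalCount V t ω) + Real.log α)
        atTop (𝓝 (Real.log (T ω))) := by
  -- The `V i` are only almost everywhere measurable, so measurable versions are used.
  set U : ℕ → Ω → ℝ := fun i => (hlaw i).aemeasurable.mk (V i) with hU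
  have hUm (i : ℕ) : Measurable (U i) := (hlaw i).aemeasurable.measurable_mk
  have hVU (i : ℕ) : V i =ᵐ[P] U i := (hlaw i).aemeasurable.ae_eq_mk
  have hUlaw (i : ℕ) : P.map (U i) = betaMeasure (1 - α) (θ + ((i : ℝ) + 1) * α) := by
    rw [← (hlaw i).map_eq]
    exact Measure.map_congr (hVU i).symm
  have hlogm : Measurable fun x : ℝ => -Real.log (1 - x) := by fun_prop
  set ξ : ℕ → Ω → ℝ := fun i ω => -Real.log (1 - U i ω) with hξ
  have hξm (i : ℕ) : Measurable (ξ i) := hlogm.comp (hUm i)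
  have hξind : iIndepFun ξ P :=
    (hindep.congr hVU).comp (fun _ x => -Real.log (1 - x)) fun _ => hlogm
  have hac : P.map (ξ 0) ≪ volume := by
    have h : P.map (ξ 0) = (P.map (U 0)).map fun x => -Real.log (1 - x) :=
      (Measure.map_map hlogm (hUm 0)).symm
    rw [h, hUlaw]
    exact map_neg_log_one_sub_betaMeasure_absolutelyContinuous _ _
  have hmom (s : ℝ) (hs : -α < θ + s) (i : ℕ) :
      Integrable (fun ω => Real.exp (-s * ξ i ω)) P ∧
        mgf (ξ i) P (-s) = stepMoment α θ s i := by
    have hi : 0 ≤ (i : ℝ) * α := by positivity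
    have h := integral_betaMeasure_exp_mul_log (a := 1 - α) (b := θ + ((i : ℝ) + 1) * α) (s := s)
      (by linarith) (by linarith) (by linarith)
    have hm : Measurable fun x : ℝ => Real.exp (s * Real.log (1 - x)) := by fun_prop
    have hexp (ω : Ω) : Real.exp (-s * ξ i ω) = Real.exp (s * Real.log (1 - U i ω)) := by
      simp [hξ]
    rw [← hUlaw, integrable_map_measure hm.aestronglyMeasurable (hUm i).aemeasurable,
      integral_map (hUm i).aemeasurable hm.aestronglyMeasurable] at h
    refine ⟨h.1.congr (ae_of_all _ fun ω => (hexp ω).symm), ?_⟩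
    rw [mgf]
    simp_rw [hexp]
    exact h.2
  obtain ⟨Y, hYm, hYac, hYlim, hYmom⟩ := exists_limit_centredSum hα0 hα1 hθ hξm hξind hac
    (fun s hs i => (hmom s hs i).1) fun s hs i => (hmom s hs i).2
  have hc : 0 < 1 / α - 1 := by
    rw [sub_pos, lt_div_iff₀ hα0]
    linarith
  have hepoch : ∀ᵐ ω ∂P, Tendsto
      (fun n : ℕ => renewalEpoch V n ω - (1 / α - 1) * Real.log n) atTop
      (𝓝 (Y ω - Real.log α)) := by
    filter_upwards [hYlim, ae_all_iff.2 hVU] with ω hω hVω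
    rw [← tendsto_add_atTop_iff_nat 1]
    refine (hω.sub_const (Real.log α)).congr fun n => ?_
    simp only [centredSum, renewalEpoch, hξ, hVω]
    push_cast
    ring
  have h0 (ω : Ω) : renewalEpoch V 0 ω = 0 := by simp [renewalEpoch]
  refine ⟨?_, fun ω => Real.exp (Y ω), hYm.exp, fun ω => Real.exp_pos _,
    isTiltedStableLaw_map_exp hα0 hα1 hθ hYm hYac hYmom, ?_⟩
  · filter_upwards [hepoch] with ω hω t ht
    exact isGreatest_sSup_setOf_le (h0 ω) (tendsto_atTop_of_tendsto_sub_log hc hω) ht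
  · filter_upwards [hepoch] with ω hω
    have h := (tendsto_sub_log_sSup_setOf_le (h0 ω) hc hω).add_const (Real.log α)
    rw [sub_add_cancel] at h
    rw [Real.log_exp]
    exact h
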